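/- Let $\Gamma$ be a finite simple graph with vertex set $V(\Gamma)$ and let $$G(\Gamma)=\langle\, v\in V(\Gamma)\mid [u,v]=1 \text{ whenever } \{u,v\}\notin E(\Gamma)\,\rangle$$ be the right-angled Artin group of $\Gamma$ (with the convention that non-adjacent vertices commute). For $g\in G(\Gamma)$ let $|g|$ be the word length of $g$ with respect to $V(\Gamma)^{\pm1}$; a word is reduced if it is a shortest word representing its element. A decomposition $g=g_1\cdots g_m$ is geodesic if $|g|=|g_1|+\cdots+|g_m|$. The support $\operatorname{supp}(g)$ is the set of vertices $v$ such that $v$ or $v^{-1}$ appears in a reduced word representing $g$. The element $g$ is non-split if $\operatorname{supp}(g)$ spans a connected subgraph of $\Gamma$, and cyclically reduced if it has minimal word length in its conjugacy class. For a vertex $v_0$, an element is $v_0$-conical if $v_0$ is the only vertex $v$ such that $v$ or $v^{-1}$ is the first letter of some reduced word representing that element. Let $g\in G(\Gamma)$ be non-split and cyclically reduced, and let $v_0\in\operatorname{supp}(g)$. Then there exist a $v_0$-conical element $p\in G(\Gamma)$, elements $a,b\in G(\Gamma)$ and an integer $k$ with $0\le k\le |V(\Gamma)|-1$ such that $$g=apa^{-1}=b^{-1}pb,$$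 and $g^k=ab$ is a geodesic decomposition. Moreover, for these $p,a,b,k$ and for every integer $n\ge |V(\Gamma)|$, $g^n=a\,p^{n-k}\,b$ is a geodesic decomposition, also when $p^{n-k}$ is written as a product of $n-k$ factors $p$; that is, $|g^n|=|a|+|p^{n-k}|+|b|=|a|+(n-k)|p|+|b|$. -/

import Mathlib

namespace RAAG

/-- The defining relators of `G(Γ)`: the commutators `[u, v]` of pairs of vertices that are
*not* joined by an edge of `Γ` (the "opposite" convention for right-angled Artin groups). -/
def relators {V : Type*} (Γ : SimpleGraph V) : Set (FreeGroup V) :=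
  {r | ∃ u v : V, ¬ Γ.Adj u v ∧
    r = FreeGroup.of u * FreeGroup.of v * (FreeGroup.of u)⁻¹ * (FreeGroup.of v)⁻¹}

/-- The right-angled Artin group
`G(Γ) = ⟨ v ∈ V(Γ) ∣ [u, v] = 1 if {u, v} ∉ E(Γ) ⟩`. -/
abbrev Grp {V : Type*} (Γ : SimpleGraph V) : Type _ := PresentedGroup (relators Γ)

/-- The group element represented by a word. The letter `(v, true)` stands for the generator `v`
and the letter `(v, false)` for its inverse. -/
def eval {V : Type*} (Γ : SimpleGraph V) (w : List (V × Bool)) : Grp Γ :=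
  PresentedGroup.mk (relators Γ) (FreeGroup.mk w)

theorem exists_eval_eq {V : Type*} (Γ : SimpleGraph V) (g : Grp Γ) :
    ∃ w : List (V × Bool), eval Γ w = g := by
  classical
  obtain ⟨x, rfl⟩ := PresentedGroup.mk_surjective (relators Γ) g
  exact ⟨x.toWord, by rw [eval, FreeGroup.mk_toWord]⟩

/-- The word length `|g|`: the smallest length of a word representing `g`
(there is such a word by `exists_eval_eq`). -/
noncomputable def length {V : Type*} {Γ : SimpleGraph V} (g : Grp Γ) : ℕ :=
  sInf {n | ∃ w : List (V × Bool), eval Γ w = g ∧ w.length = n}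

/-- `w` is a reduced word representing `g`: a shortest one among all words representing `g`. -/
def IsReducedWordOf {V : Type*} {Γ : SimpleGraph V} (w : List (V × Bool)) (g : Grp Γ) : Prop :=
  eval Γ w = g ∧ ∀ w' : List (V × Bool), eval Γ w' = g → w.length ≤ w'.length

/-- The support of `g`: the vertices `v` such that `v` or `v⁻¹` appears in a reduced word
representing `g`. -/
def supp {V : Type*} {Γ : SimpleGraph V} (g : Grp Γ) : Set V :=
  {v | ∃ w : List (V × Bool), IsReducedWordOf w g ∧ ∃ ε : Bool, (v, ε) ∈ w}

/-- `g` is non-split if its support spans a connected subgraph of `Γ`. -/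
def IsNonSplit {V : Type*} {Γ : SimpleGraph V} (g : Grp Γ) : Prop :=
  (Γ.induce (supp g)).Connected

/-- `g` is cyclically reduced if it has minimal word length in its conjugacy class. -/
def IsCyclicallyReduced {V : Type*} {Γ : SimpleGraph V} (g : Grp Γ) : Prop :=
  ∀ h : Grp Γ, IsConj g h → length g ≤ length h

/-- The set `S(g)` of starting generators: the vertices `v` such that `v` or `v⁻¹` is the first
letter of a reduced word representing `g`. -/
def startingGenerators {V : Type*} {Γ : SimpleGraph V} (g : Grp Γ) : Set V :=
  {v | ∃ (ε : Bool) (w : List (V × Bool)), IsReducedWordOf ((v, ε) :: w) g}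

/-- `g` is `v₀`-conical if `S(g) = {v₀}`. -/
def IsConical {V : Type*} {Γ : SimpleGraph V} (v₀ : V) (g : Grp Γ) : Prop :=
  startingGenerators g = {v₀}

/-- `g = g₁ ⋯ gₘ` is a geodesic decomposition, where `l = [g₁, …, gₘ]`:
the product is `g` and `|g| = |g₁| + ⋯ + |gₘ|`. -/
def IsGeodesicDecomposition {V : Type*} {Γ : SimpleGraph V} (g : Grp Γ) (l : List (Grp Γ)) :
    Prop :=
  g = l.prod ∧ length g = (l.map length).sum

end RAAG

/-!
A word drops one bead per letter on a row of stacks, one for each vertex, and a blank on each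
adjacent stack. This pile of beads determines the group element, and for a word without cancelling
beads it is determined by the element: the group acts by left multiplication on cancellation-free
piles. Reduced words are thus the cancellation-free ones, and all questions about starting letters,
supports and geodesic products are read off from piles. In particular, the powers of a cyclically
reduced word are reduced.

Write `g = s * t` geodesically with `s` a longest prefix avoiding `v₀`; then `t` is `v₀`-conical.
Rotate to the conjugate `t * s`, which is again cyclically reduced with the same support, and split
it likewise as `s' * t'`. A letter of `s'` can only start `t * s` by commuting past the conical
element `t`, so the vertices of `s'` lie in `supp s` and are adjacent to no vertex of `supp t`. If
`s ≠ 1`, connectedness of `supp g` makes the inclusion `supp s' ⊆ supp s` strict. Hence fewer than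
`|supp g|` rotations lead to a conical conjugate, and multiplying up the pieces moved by `k`
rotations gives `g ^ k = a * b`.
-/

namespace RAAG

open List

section Evaluation

variable {V : Type*} (Γ : SimpleGraph V)

theorem eval_nil : eval Γ [] = 1 := rfl

theorem eval_append (w w' : List (V × Bool)) : eval Γ (w ++ w') = eval Γ w * eval Γ w' := by
  rw [eval, ← FreeGroup.mul_mk, map_mul]
  rfl

theorem eval_cons (x : V × Bool) (w : List (V × Bool)) :
    eval Γ (x :: w) = eval Γ [x] * eval Γ w :=
  eval_append Γ [x] w

theorem eval_inv_letter (x : V × Bool) : eval Γ [(x.1, !x.2)] = (eval Γ [x])⁻¹ := by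
  rw [eval, eval, ← map_inv, FreeGroup.inv_mk]
  rfl

theorem eval_flatten_replicate (n : ℕ) (w : List (V × Bool)) :
    eval Γ (replicate n w).flatten = eval Γ w ^ n := by
  induction n with
  | zero => rfl
  | succ n ih => rw [replicate_succ, flatten_cons, eval_append, ih, pow_succ']

variable {Γ}

theorem commute_eval_generators {u v : V} (h : ¬ Γ.Adj u v) :
    Commute (eval Γ [(u, true)]) (eval Γ [(v, true)]) := by
  have hrel : PresentedGroup.mk (relators Γ)
      (FreeGroup.of u * FreeGroup.of v * (FreeGroup.of u)⁻¹ * (FreeGroup.of v)⁻¹) = 1 :=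
    PresentedGroup.one_of_mem ⟨u, v, h, rfl⟩
  rw [map_mul, map_mul, map_mul, map_inv, map_inv, mul_inv_eq_one, mul_inv_eq_iff_eq_mul] at hrel
  exact hrel

theorem commute_eval_letters {x y : V × Bool} (h : ¬ Γ.Adj x.1 y.1) :
    Commute (eval Γ [x]) (eval Γ [y]) := by
  obtain ⟨u, δ⟩ := x
  obtain ⟨v, ε⟩ := y
  have hcomm := commute_eval_generators h
  have hu : eval Γ [(u, false)] = (eval Γ [(u, true)])⁻¹ := eval_inv_letter Γ (u, true)
  have hv : eval Γ [(v, false)] = (eval Γ [(v, true)])⁻¹ := eval_inv_letter Γ (v, true)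
  cases δ <;> cases ε <;> simp only [hu, hv, Commute.inv_left_iff, Commute.inv_right_iff, hcomm]

end Evaluation

section Length

variable {V : Type*} {Γ : SimpleGraph V} {g h : Grp Γ} {w : List (V × Bool)}

theorem length_eval_le (w : List (V × Bool)) : length (eval Γ w) ≤ w.length :=
  Nat.sInf_le ⟨w, rfl, rfl⟩

theorem exists_eval_eq_length_eq (g : Grp Γ) :
    ∃ w : List (V × Bool), eval Γ w = g ∧ w.length = length g :=
  let ⟨w, hw⟩ := exists_eval_eq Γ g
  Nat.sInf_mem (s := {n | ∃ w : List (V × Bool), eval Γ w = g ∧ w.length = n}) ⟨_, w, hw, rfl⟩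

theorem isReducedWordOf_iff_length_eq :
    IsReducedWordOf w g ↔ eval Γ w = g ∧ w.length = length g := by
  constructor
  · rintro ⟨rfl, hmin⟩
    obtain ⟨w', hw', hl⟩ := exists_eval_eq_length_eq (eval Γ w)
    exact ⟨rfl, le_antisymm (hl ▸ hmin w' hw') (length_eval_le w)⟩
  · rintro ⟨rfl, hl⟩
    exact ⟨rfl, fun w' hw' => hl ▸ hw' ▸ length_eval_le w'⟩

theorem exists_isReducedWordOf (g : Grp Γ) : ∃ w, IsReducedWordOf w g :=
  let ⟨w, hw⟩ := exists_eval_eq_length_eq g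
  ⟨w, isReducedWordOf_iff_length_eq.2 hw⟩

theorem length_one : length (1 : Grp Γ) = 0 :=
  Nat.le_zero.1 (length_eval_le [])

theorem length_mul_le (g h : Grp Γ) : length (g * h) ≤ length g + length h := by
  obtain ⟨w, rfl, hw⟩ := exists_eval_eq_length_eq g
  obtain ⟨w', rfl, hw'⟩ := exists_eval_eq_length_eq h
  rw [← hw, ← hw', ← eval_append, ← length_append]
  exact length_eval_le _

theorem length_prod_le (l : List (Grp Γ)) : length l.prod ≤ (l.map length).sum := by
  induction l with
  | nil => exact length_one.le
  | cons g l ih =>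
    rw [prod_cons, map_cons, sum_cons]
    exact (length_mul_le _ _).trans (Nat.add_le_add_left ih _)

theorem length_pow_le (g : Grp Γ) (n : ℕ) : length (g ^ n) ≤ n * length g := by
  simpa using length_prod_le (replicate n g)

theorem isGeodesicDecomposition_of_sum_le {l : List (Grp Γ)} (hprod : g = l.prod)
    (hsum : (l.map length).sum ≤ length g) : IsGeodesicDecomposition g l :=
  ⟨hprod, le_antisymm (hprod ▸ length_prod_le l) hsum⟩

theorem isGeodesicDecomposition_pair_iff {a b : Grp Γ} :
    IsGeodesicDecomposition g [a, b] ↔ g = a * b ∧ length g = length a + length b := by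
  simp [IsGeodesicDecomposition]

theorem IsReducedWordOf.append {a b : Grp Γ} {u : List (V × Bool)}
    (hg : IsGeodesicDecomposition g [a, b]) (hu : IsReducedWordOf u a)
    (hw : IsReducedWordOf w b) : IsReducedWordOf (u ++ w) g := by
  rw [isGeodesicDecomposition_pair_iff] at hg
  rw [isReducedWordOf_iff_length_eq] at hu hw ⊢
  exact ⟨by rw [eval_append, hu.1, hw.1, hg.1], by rw [length_append, hu.2, hw.2, hg.2]⟩

theorem IsCyclicallyReduced.of_isConj (hg : IsCyclicallyReduced g) (hgh : IsConj g h)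
    (hle : length h ≤ length g) : IsCyclicallyReduced h :=
  fun _ hh => hle.trans (hg _ (hgh.trans hh))

end Length

section Pile

variable {V : Type*} (Γ : SimpleGraph V)

open Classical in
/-- The pile of a word: a letter `v ^ ±1` puts a signed bead (`some ε`) on the stack of `v` and a
blank (`none`) on the stack of every neighbour of `v`. The head of a list is the entry of the
leftmost letter. Two words have the same pile iff they differ by swaps of commuting letters with
distinct vertices. -/
noncomputable def pile (w : List (V × Bool)) (v : V) : List (Option Bool) :=
  w.flatMap fun x => if x.1 = v then [some x.2] else if Γ.Adj v x.1 then [none] else []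

/-- `x` can be moved to the front of `w` by swaps of commuting letters with distinct vertices. -/
def IsStartingLetter (x : V × Bool) (w : List (V × Bool)) : Prop :=
  (pile Γ w x.1).head? = some (some x.2)

/-- No swaps of commuting letters bring two mutually inverse letters of `w` side by side; in terms
of the pile, no bead lies directly on a bead of the opposite sign. -/
def IsCancellationFree (w : List (V × Bool)) : Prop :=
  ∀ v, (pile Γ w v).IsChain fun b c => ∀ ε, b = some ε → c ≠ some !ε

variable {Γ} {v : V} {x y : V × Bool} {w w' : List (V × Bool)}

theorem pile_append (w w' : List (V × Bool)) (v : V) :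
    pile Γ (w ++ w') v = pile Γ w v ++ pile Γ w' v :=
  flatMap_append

theorem pile_cons_self (x : V × Bool) (w : List (V × Bool)) :
    pile Γ (x :: w) x.1 = some x.2 :: pile Γ w x.1 := by
  simp [pile]

theorem pile_cons_of_not_adj (hne : x.1 ≠ v) (hadj : ¬ Γ.Adj v x.1) (w : List (V × Bool)) :
    pile Γ (x :: w) v = pile Γ w v := by
  simp [pile, hne, hadj]

theorem pile_cons_of_adj (hadj : Γ.Adj v x.1) (w : List (V × Bool)) :
    pile Γ (x :: w) v = none :: pile Γ w v := by
  simp [pile, hadj, hadj.ne']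

theorem pile_flatten_replicate (n : ℕ) (w : List (V × Bool)) (v : V) :
    pile Γ (replicate n w).flatten v = (replicate n (pile Γ w v)).flatten := by
  simp only [pile, flatMap, map_flatten, map_replicate, flatten_flatten]

theorem pile_append_congr {u u' : List (V × Bool)} (hu : pile Γ u = pile Γ u')
    (hw : pile Γ w = pile Γ w') : pile Γ (u ++ w) = pile Γ (u' ++ w') := by
  funext v
  rw [pile_append, pile_append, hu, hw]

theorem pile_append_left_cancel {u : List (V × Bool)}
    (h : pile Γ (u ++ w) = pile Γ (u ++ w')) : pile Γ w = pile Γ w' := by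
  funext v
  have hv := congrFun h v
  rwa [pile_append, pile_append, append_right_inj] at hv

theorem pile_cons_congr (x : V × Bool) (h : pile Γ w = pile Γ w') :
    pile Γ (x :: w) = pile Γ (x :: w') :=
  pile_append_congr (u := [x]) rfl h

theorem pile_cons_cancel (h : pile Γ (x :: w) = pile Γ (x :: w')) :
    pile Γ w = pile Γ w' :=
  pile_append_left_cancel (u := [x]) h

theorem pile_cons_cons_comm (hne : x.1 ≠ y.1) (hadj : ¬ Γ.Adj x.1 y.1) (w : List (V × Bool)) :
    pile Γ (x :: y :: w) = pile Γ (y :: x :: w) := by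
  have hadj' : ¬ Γ.Adj y.1 x.1 := fun h => hadj h.symm
  funext v
  by_cases hx : x.1 = v
  · subst hx
    rw [pile_cons_self, pile_cons_of_not_adj hne.symm hadj,
      pile_cons_of_not_adj hne.symm hadj, pile_cons_self]
  by_cases hy : y.1 = v
  · subst hy
    rw [pile_cons_self, pile_cons_of_not_adj hne hadj', pile_cons_self,
      pile_cons_of_not_adj hne hadj']
  simp only [pile, flatMap_cons, if_neg hx, if_neg hy]
  split_ifs <;> rfl

theorem pile_eq_nil_iff :
    pile Γ w v = [] ↔ ∀ y ∈ w, y.1 ≠ v ∧ ¬ Γ.Adj v y.1 := by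
  simp only [pile, flatMap_eq_nil_iff]
  refine forall₂_congr fun y _ => ?_
  split_ifs <;> simp_all

theorem count_some_pile [DecidableEq V] (v : V) (ε : Bool) (w : List (V × Bool)) :
    (pile Γ w v).count (some ε) = w.count (v, ε) := by
  induction w with
  | nil => rfl
  | cons x w ih =>
    by_cases hx : x.1 = v
    · subst hx
      rw [pile_cons_self, count_cons, count_cons, ih]
      simp [Prod.ext_iff]
    · have hxv : x ≠ (v, ε) := fun h => hx (h ▸ rfl)
      rw [count_cons_of_ne hxv, ← ih]
      by_cases hadj : Γ.Adj v x.1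
      · rw [pile_cons_of_adj hadj, count_cons_of_ne (by simp)]
      · rw [pile_cons_of_not_adj hx hadj]

theorem perm_of_pile_eq (h : pile Γ w = pile Γ w') : w ~ w' := by
  classical
  refine perm_iff_count.2 fun x => ?_
  rw [← count_some_pile (Γ := Γ), h, count_some_pile]

theorem IsStartingLetter.congr (h : pile Γ w = pile Γ w') (hx : IsStartingLetter Γ x w) :
    IsStartingLetter Γ x w' := by
  rwa [IsStartingLetter, ← h]

theorem isStartingLetter_cons_self (x : V × Bool) (w : List (V × Bool)) :
    IsStartingLetter Γ x (x :: w) := by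
  rw [IsStartingLetter, pile_cons_self, head?_cons]

theorem isStartingLetter_append_iff {u : List (V × Bool)} :
    IsStartingLetter Γ x (u ++ w) ↔
      IsStartingLetter Γ x u ∨ pile Γ u x.1 = [] ∧ IsStartingLetter Γ x w := by
  unfold IsStartingLetter
  rw [pile_append]
  cases pile Γ u x.1 <;> simp

theorem isStartingLetter_cons_iff_of_ne (hxy : y ≠ x) :
    IsStartingLetter Γ x (y :: w) ↔
      y.1 ≠ x.1 ∧ ¬ Γ.Adj x.1 y.1 ∧ IsStartingLetter Γ x w := by
  unfold IsStartingLetter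
  by_cases hv : y.1 = x.1
  · have hε : y.2 ≠ x.2 := fun hε => hxy (Prod.ext hv hε)
    rw [← hv, pile_cons_self]
    simp [hε]
  by_cases hadj : Γ.Adj x.1 y.1
  · simp [pile_cons_of_adj hadj, hadj]
  · simp [pile_cons_of_not_adj hv hadj, hv, hadj]

theorem IsStartingLetter.pile_cons_erase [DecidableEq V] (hx : IsStartingLetter Γ x w) :
    pile Γ (x :: w.erase x) = pile Γ w := by
  induction w with
  | nil => simp [IsStartingLetter, pile] at hx
  | cons y w ih =>
    by_cases hyx : y = x
    · rw [hyx, erase_cons_head]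
    obtain ⟨hne, hadj, hx⟩ := (isStartingLetter_cons_iff_of_ne hyx).1 hx
    rw [erase_cons_tail (by simpa using hyx), pile_cons_cons_comm hne.symm hadj]
    exact pile_cons_congr y (ih hx)

theorem IsStartingLetter.eval_cons_erase [DecidableEq V] (hx : IsStartingLetter Γ x w) :
    eval Γ (x :: w.erase x) = eval Γ w := by
  induction w with
  | nil => simp [IsStartingLetter, pile] at hx
  | cons y w ih =>
    by_cases hyx : y = x
    · rw [hyx, erase_cons_head]
    obtain ⟨-, hadj, hx⟩ := (isStartingLetter_cons_iff_of_ne hyx).1 hx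
    rw [erase_cons_tail (by simpa using hyx), eval_cons, eval_cons Γ y, ← mul_assoc,
      (commute_eval_letters hadj).eq, mul_assoc, ← eval_cons, ih hx, ← eval_cons]

theorem IsStartingLetter.mem (hx : IsStartingLetter Γ x w) : x ∈ w := by
  classical exact (perm_of_pile_eq hx.pile_cons_erase).subset mem_cons_self

theorem eval_eq_of_pile_eq (h : pile Γ w = pile Γ w') : eval Γ w = eval Γ w' := by
  classical
  induction w' generalizing w with
  | nil => rw [(perm_of_pile_eq h).eq_nil]
  | cons x w' ih =>
    have hx : IsStartingLetter Γ x w := (isStartingLetter_cons_self x w').congr h.symm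
    have herase := ih (pile_cons_cancel (hx.pile_cons_erase.trans h))
    rw [← hx.eval_cons_erase, eval_cons, herase, ← eval_cons]

end Pile

section CancellationFree

variable {V : Type*} {Γ : SimpleGraph V} {x : V × Bool} {w w' : List (V × Bool)}

theorem isCancellationFree_nil : IsCancellationFree Γ [] :=
  fun _ => .nil

theorem IsCancellationFree.congr (h : pile Γ w = pile Γ w') (hw : IsCancellationFree Γ w) :
    IsCancellationFree Γ w' := by
  rwa [IsCancellationFree, ← h]

theorem isCancellationFree_cons_iff : IsCancellationFree Γ (x :: w) ↔
    ¬ IsStartingLetter Γ (x.1, !x.2) w ∧ IsCancellationFree Γ w := by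
  constructor
  · intro h
    constructor
    · have hx := h x.1
      rw [pile_cons_self, isChain_cons] at hx
      exact fun hinv => hx.1 _ hinv _ rfl rfl
    · exact fun v => (pile_append [x] w v ▸ h v).right_of_append
  · rintro ⟨hx, hw⟩ v
    by_cases hv : x.1 = v
    · subst hv
      rw [pile_cons_self, isChain_cons]
      refine ⟨?_, hw _⟩
      rintro _ hhead ε hε rfl
      rw [← Option.some.inj hε] at hhead
      exact hx hhead
    by_cases hadj : Γ.Adj v x.1
    · rw [pile_cons_of_adj hadj, isChain_cons]
      refine ⟨fun _ _ _ h => ?_, hw v⟩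
      cases h
    · rw [pile_cons_of_not_adj hv hadj]
      exact hw v

theorem IsCancellationFree.of_append {u : List (V × Bool)} (h : IsCancellationFree Γ (u ++ w)) :
    IsCancellationFree Γ u ∧ IsCancellationFree Γ w := by
  constructor
  · exact fun v => (pile_append u w v ▸ h v).left_of_append
  · exact fun v => (pile_append u w v ▸ h v).right_of_append

end CancellationFree

section NormalForm

variable {V : Type*} (Γ : SimpleGraph V)

open Classical in
/-- Left multiplication by the letter `x` on cancellation-free words, up to equality of piles:
`x` cancels against an inverse letter that can be moved to the front, or else is prepended. -/
noncomputable def letterMul (x : V × Bool) (w : List (V × Bool)) : List (V × Bool) :=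
  if IsStartingLetter Γ (x.1, !x.2) w then w.erase (x.1, !x.2) else x :: w

/-- The letters of `w` multiplied together, from the right, by `letterMul`: a cancellation-free word
with the same value as `w`. -/
noncomputable def normalForm (w : List (V × Bool)) : List (V × Bool) :=
  w.foldr (letterMul Γ) []

variable {Γ} {x y : V × Bool} {w w' : List (V × Bool)}

theorem letterMul_of_not_isStartingLetter (h : ¬ IsStartingLetter Γ (x.1, !x.2) w) :
    letterMul Γ x w = x :: w :=
  if_neg h

theorem pile_cons_letterMul (h : IsStartingLetter Γ (x.1, !x.2) w) :
    pile Γ ((x.1, !x.2) :: letterMul Γ x w) = pile Γ w := by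
  classical
  rw [letterMul, if_pos h]
  exact h.pile_cons_erase

theorem letterMul_subperm (x : V × Bool) (w : List (V × Bool)) : letterMul Γ x w <+~ x :: w := by
  classical
  unfold letterMul
  split_ifs
  · exact (erase_sublist.trans (sublist_cons_self x w)).subperm
  · exact Subperm.refl _

theorem eval_letterMul (x : V × Bool) (w : List (V × Bool)) :
    eval Γ (letterMul Γ x w) = eval Γ (x :: w) := by
  by_cases h : IsStartingLetter Γ (x.1, !x.2) w
  · rw [eval_cons, ← eval_eq_of_pile_eq (pile_cons_letterMul h), eval_cons Γ (x.1, !x.2),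
      eval_inv_letter, mul_inv_cancel_left]
  · rw [letterMul_of_not_isStartingLetter h]

theorem IsCancellationFree.letterMul (hw : IsCancellationFree Γ w) (x : V × Bool) :
    IsCancellationFree Γ (letterMul Γ x w) := by
  by_cases h : IsStartingLetter Γ (x.1, !x.2) w
  · exact (isCancellationFree_cons_iff.1 (hw.congr (pile_cons_letterMul h).symm)).2
  · rw [letterMul_of_not_isStartingLetter h]
    exact isCancellationFree_cons_iff.2 ⟨h, hw⟩

theorem pile_letterMul_congr (x : V × Bool) (h : pile Γ w = pile Γ w') :
    pile Γ (letterMul Γ x w) = pile Γ (letterMul Γ x w') := by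
  by_cases hx : IsStartingLetter Γ (x.1, !x.2) w
  · refine pile_cons_cancel (x := (x.1, !x.2)) ?_
    rw [pile_cons_letterMul hx, h, pile_cons_letterMul (hx.congr h)]
  · rw [letterMul_of_not_isStartingLetter hx,
      letterMul_of_not_isStartingLetter fun hx' => hx (hx'.congr h.symm)]
    exact pile_cons_congr x h

theorem pile_inv_letterMul_letterMul (hw : IsCancellationFree Γ w) (x : V × Bool) :
    pile Γ (letterMul Γ (x.1, !x.2) (letterMul Γ x w)) = pile Γ w := by
  by_cases h : IsStartingLetter Γ (x.1, !x.2) w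
  · have hpile := pile_cons_letterMul h
    have hfree := (isCancellationFree_cons_iff.1 (hw.congr hpile.symm)).1
    rw [letterMul_of_not_isStartingLetter hfree, hpile]
  · rw [letterMul_of_not_isStartingLetter h]
    have hx : IsStartingLetter Γ (x.1, !!x.2) (x :: w) := by
      rw [Bool.not_not]
      exact isStartingLetter_cons_self x w
    have hpile := pile_cons_letterMul (x := (x.1, !x.2)) hx
    simp only [Bool.not_not] at hpile
    exact pile_cons_cancel hpile

theorem isStartingLetter_letterMul_iff (hne : x.1 ≠ y.1) (hadj : ¬ Γ.Adj x.1 y.1) :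
    IsStartingLetter Γ x (letterMul Γ y w) ↔ IsStartingLetter Γ x w := by
  have hcons (δ : Bool) (u : List (V × Bool)) :
      IsStartingLetter Γ x ((y.1, δ) :: u) ↔ IsStartingLetter Γ x u := by
    rw [IsStartingLetter, pile_cons_of_not_adj (x := (y.1, δ)) hne.symm hadj, IsStartingLetter]
  by_cases hy : IsStartingLetter Γ (y.1, !y.2) w
  · rw [← hcons (!y.2), IsStartingLetter, pile_cons_letterMul hy, IsStartingLetter]
  · rw [letterMul_of_not_isStartingLetter hy]
    exact hcons y.2 w

theorem pile_letterMul_cons_comm (hne : x.1 ≠ y.1) (hadj : ¬ Γ.Adj x.1 y.1) :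
    pile Γ (letterMul Γ x (y :: w)) = pile Γ (y :: letterMul Γ x w) := by
  have hstart : IsStartingLetter Γ (x.1, !x.2) (y :: w) ↔ IsStartingLetter Γ (x.1, !x.2) w := by
    rw [IsStartingLetter, pile_cons_of_not_adj hne.symm hadj, IsStartingLetter]
  by_cases hx : IsStartingLetter Γ (x.1, !x.2) w
  · refine pile_cons_cancel (x := (x.1, !x.2)) ?_
    rw [pile_cons_letterMul (hstart.2 hx), pile_cons_cons_comm (x := (x.1, !x.2)) hne hadj]
    exact (pile_cons_congr y (pile_cons_letterMul hx)).symm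
  · rw [letterMul_of_not_isStartingLetter hx,
      letterMul_of_not_isStartingLetter (mt hstart.1 hx), pile_cons_cons_comm hne hadj]

theorem pile_letterMul_comm (hne : x.1 ≠ y.1) (hadj : ¬ Γ.Adj x.1 y.1) :
    pile Γ (letterMul Γ x (letterMul Γ y w)) = pile Γ (letterMul Γ y (letterMul Γ x w)) := by
  by_cases hy : IsStartingLetter Γ (y.1, !y.2) w
  · refine pile_cons_cancel (x := (y.1, !y.2)) ?_
    have hy' := (isStartingLetter_letterMul_iff (x := (y.1, !y.2)) (w := w) hne.symm
      fun h => hadj h.symm).2 hy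
    rw [← pile_letterMul_cons_comm (y := (y.1, !y.2)) hne hadj, pile_cons_letterMul hy']
    exact pile_letterMul_congr x (pile_cons_letterMul hy)
  · have hy' := mt (isStartingLetter_letterMul_iff (x := (y.1, !y.2)) (w := w) hne.symm
      fun h => hadj h.symm).1 hy
    rw [letterMul_of_not_isStartingLetter hy, letterMul_of_not_isStartingLetter hy',
      pile_letterMul_cons_comm hne hadj]

variable (Γ)

/-- Cancellation-free words up to equality of piles. The group acts on them by left
multiplication, which makes piles an invariant of group elements. -/
abbrev PileClass : Type _ :=
  Quotient (Setoid.ker fun w : {w : List (V × Bool) // IsCancellationFree Γ w} => pile Γ w.1)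

variable {Γ} in
/-- The class of a cancellation-free word. -/
noncomputable def PileClass.mk (w : List (V × Bool)) (hw : IsCancellationFree Γ w) : PileClass Γ :=
  Quotient.mk _ ⟨w, hw⟩

/-- Left multiplication by a letter, on classes. -/
noncomputable def PileClass.letterMul (x : V × Bool) : PileClass Γ → PileClass Γ :=
  Quotient.map (fun w => ⟨RAAG.letterMul Γ x w.1, w.2.letterMul x⟩)
    fun _ _ h => pile_letterMul_congr x h

/-- Left multiplication by a generator, as a permutation of the classes. -/
noncomputable def generatorPerm (v : V) : Equiv.Perm (PileClass Γ) where
  toFun := PileClass.letterMul Γ (v, true)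
  invFun := PileClass.letterMul Γ (v, false)
  left_inv := by
    rintro ⟨w, hw⟩
    exact Quotient.sound (pile_inv_letterMul_letterMul hw (v, true))
  right_inv := by
    rintro ⟨w, hw⟩
    exact Quotient.sound (pile_inv_letterMul_letterMul hw (v, false))

variable {Γ} in
theorem commute_generatorPerm {u v : V} (h : ¬ Γ.Adj u v) :
    Commute (generatorPerm Γ u) (generatorPerm Γ v) := by
  obtain rfl | hne := eq_or_ne u v
  · exact Commute.refl _
  · ext ⟨w, hw⟩
    exact Quotient.sound (pile_letterMul_comm (x := (u, true)) (y := (v, true)) hne h)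

/-- The action of `G(Γ)` by left multiplication on classes of cancellation-free words. -/
noncomputable def pileHom : Grp Γ →* Equiv.Perm (PileClass Γ) :=
  PresentedGroup.toGroup (f := generatorPerm Γ) <| by
    rintro _ ⟨u, v, h, rfl⟩
    simp only [map_mul, map_inv, FreeGroup.lift_apply_of, mul_inv_eq_iff_eq_mul, one_mul]
    exact commute_generatorPerm h

theorem pileHom_eval_letter (x : V × Bool) (c : PileClass Γ) :
    pileHom Γ (eval Γ [x]) c = PileClass.letterMul Γ x c := by
  obtain ⟨v, ε⟩ := x
  have hgen : pileHom Γ (eval Γ [(v, true)]) = generatorPerm Γ v := PresentedGroup.toGroup.of _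
  cases ε
  · have hinv : eval Γ [(v, false)] = (eval Γ [(v, true)])⁻¹ := eval_inv_letter Γ (v, true)
    rw [hinv, map_inv, hgen]
    rfl
  · rw [hgen]
    rfl

variable {Γ}

theorem isCancellationFree_normalForm (w : List (V × Bool)) :
    IsCancellationFree Γ (normalForm Γ w) := by
  induction w with
  | nil => exact isCancellationFree_nil
  | cons x w ih => exact ih.letterMul x

theorem normalForm_subperm (w : List (V × Bool)) : normalForm Γ w <+~ w := by
  induction w with
  | nil => exact Subperm.refl _
  | cons x w ih => exact (letterMul_subperm x _).trans ((subperm_cons x).2 ih)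

theorem IsCancellationFree.normalForm_eq (hw : IsCancellationFree Γ w) : normalForm Γ w = w := by
  induction w with
  | nil => rfl
  | cons x w ih =>
    obtain ⟨hx, hw⟩ := isCancellationFree_cons_iff.1 hw
    change RAAG.letterMul Γ x (normalForm Γ w) = x :: w
    rw [ih hw, letterMul_of_not_isStartingLetter hx]

theorem pileHom_eval (w : List (V × Bool)) :
    pileHom Γ (eval Γ w) (.mk [] isCancellationFree_nil) =
      .mk (normalForm Γ w) (isCancellationFree_normalForm w) := by
  induction w with
  | nil => rw [eval_nil, map_one]; rfl
  | cons x w ih =>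
    rw [eval_cons, map_mul, Equiv.Perm.mul_apply, ih, pileHom_eval_letter]
    rfl

theorem pile_normalForm_eq_of_eval_eq (h : eval Γ w = eval Γ w') :
    pile Γ (normalForm Γ w) = pile Γ (normalForm Γ w') :=
  Quotient.exact <| (pileHom_eval w).symm.trans <|
    (congrArg (pileHom Γ · _) h).trans (pileHom_eval w')

theorem IsCancellationFree.pile_eq_of_eval_eq (hw : IsCancellationFree Γ w)
    (hw' : IsCancellationFree Γ w') (h : eval Γ w = eval Γ w') : pile Γ w = pile Γ w' := by
  rw [← hw.normalForm_eq, ← hw'.normalForm_eq, pile_normalForm_eq_of_eval_eq h]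

theorem IsCancellationFree.subperm_of_eval_eq (hw : IsCancellationFree Γ w)
    (h : eval Γ w = eval Γ w') : w <+~ w' := by
  have hpile := pile_normalForm_eq_of_eval_eq h
  rw [hw.normalForm_eq] at hpile
  exact (perm_of_pile_eq hpile).subperm.trans (normalForm_subperm w')

theorem isCancellationFree_iff_length_eval_eq :
    IsCancellationFree Γ w ↔ length (eval Γ w) = w.length := by
  constructor
  · intro hw
    obtain ⟨w', hw', hl⟩ := exists_eval_eq_length_eq (eval Γ w)
    exact le_antisymm (length_eval_le w) (hl ▸ (hw.subperm_of_eval_eq hw'.symm).length_le)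
  · intro hl
    induction w with
    | nil => exact isCancellationFree_nil
    | cons x w ih =>
      rw [length_cons] at hl
      refine isCancellationFree_cons_iff.2 ⟨fun hx => ?_, ih ?_⟩
      · have hcancel := (perm_of_pile_eq (pile_cons_letterMul hx)).length_eq
        have hle := length_eval_le (Γ := Γ) (letterMul Γ x w)
        rw [eval_letterMul] at hle
        rw [length_cons] at hcancel
        omega
      · have hmul := length_mul_le (eval Γ [x]) (eval Γ w)
        have hx := length_eval_le (Γ := Γ) [x]
        have hw := length_eval_le (Γ := Γ) w
        rw [← eval_cons] at hmul
        rw [length_singleton] at hx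
        omega

end NormalForm

section ReducedWord

variable {V : Type*} {Γ : SimpleGraph V} {g a b : Grp Γ} {v : V} {w w' : List (V × Bool)}

theorem isReducedWordOf_iff : IsReducedWordOf w g ↔ eval Γ w = g ∧ IsCancellationFree Γ w := by
  rw [isReducedWordOf_iff_length_eq, isCancellationFree_iff_length_eval_eq]
  refine and_congr_right fun h => ?_
  rw [h, eq_comm]

theorem IsReducedWordOf.pile_eq (hw : IsReducedWordOf w g) (hw' : IsReducedWordOf w' g) :
    pile Γ w = pile Γ w' := by
  obtain ⟨heval, hfree⟩ := isReducedWordOf_iff.1 hw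
  obtain ⟨heval', hfree'⟩ := isReducedWordOf_iff.1 hw'
  exact hfree.pile_eq_of_eval_eq hfree' (heval.trans heval'.symm)

theorem IsReducedWordOf.of_pile_eq (hw : IsReducedWordOf w g) (h : pile Γ w = pile Γ w') :
    IsReducedWordOf w' g := by
  obtain ⟨heval, hfree⟩ := isReducedWordOf_iff.1 hw
  exact isReducedWordOf_iff.2 ⟨eval_eq_of_pile_eq h ▸ heval, hfree.congr h⟩

theorem IsReducedWordOf.of_append {u : List (V × Bool)} (h : IsReducedWordOf (u ++ w) g) :
    IsReducedWordOf u (eval Γ u) ∧ IsReducedWordOf w (eval Γ w) := by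
  obtain ⟨hu, hw⟩ := (isReducedWordOf_iff.1 h).2.of_append
  exact ⟨isReducedWordOf_iff.2 ⟨rfl, hu⟩, isReducedWordOf_iff.2 ⟨rfl, hw⟩⟩

theorem IsReducedWordOf.isGeodesicDecomposition {u : List (V × Bool)}
    (h : IsReducedWordOf (u ++ w) g) : IsGeodesicDecomposition g [eval Γ u, eval Γ w] := by
  obtain ⟨hu, hw⟩ := h.of_append
  rw [isReducedWordOf_iff_length_eq] at h hu hw
  rw [isGeodesicDecomposition_pair_iff, ← eval_append, h.1, ← h.2, ← hu.2, ← hw.2, length_append]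
  exact ⟨rfl, rfl⟩

theorem IsReducedWordOf.mem_startingGenerators_iff (hw : IsReducedWordOf w g) :
    v ∈ startingGenerators g ↔ ∃ ε, IsStartingLetter Γ (v, ε) w := by
  classical
  refine exists_congr fun ε => ⟨?_, fun hv => ⟨w.erase (v, ε), ?_⟩⟩
  · rintro ⟨u, hu⟩
    exact (isStartingLetter_cons_self (v, ε) u).congr (hu.pile_eq hw)
  · exact hw.of_pile_eq hv.pile_cons_erase.symm

theorem IsReducedWordOf.mem_supp_iff (hw : IsReducedWordOf w g) :
    v ∈ supp g ↔ ∃ ε, (v, ε) ∈ w := by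
  refine ⟨?_, fun hv => ⟨w, hw, hv⟩⟩
  rintro ⟨w', hw', ε, hv⟩
  exact ⟨ε, (perm_of_pile_eq (hw'.pile_eq hw)).subset hv⟩

theorem finite_supp (g : Grp Γ) : (supp g).Finite := by
  obtain ⟨w, hw⟩ := exists_isReducedWordOf g
  refine (w.map Prod.fst).finite_toSet.subset fun v hv => ?_
  obtain ⟨ε, hε⟩ := hw.mem_supp_iff.1 hv
  exact mem_map.2 ⟨_, hε, rfl⟩

theorem eq_one_of_supp_eq_empty (hg : supp g = ∅) : g = 1 := by
  obtain ⟨w, hw⟩ := exists_isReducedWordOf g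
  have hnil : w = [] := eq_nil_iff_forall_not_mem.2 fun x hx =>
    Set.eq_empty_iff_forall_notMem.1 hg x.1 (hw.mem_supp_iff.2 ⟨x.2, hx⟩)
  rw [← hw.1, hnil, eval_nil]

theorem supp_eq_union_of_isGeodesicDecomposition (hg : IsGeodesicDecomposition g [a, b]) :
    supp g = supp a ∪ supp b := by
  obtain ⟨u, hu⟩ := exists_isReducedWordOf a
  obtain ⟨w, hw⟩ := exists_isReducedWordOf b
  ext v
  rw [(hu.append hg hw).mem_supp_iff, Set.mem_union, hu.mem_supp_iff, hw.mem_supp_iff,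
    ← exists_or]
  simp only [mem_append]

end ReducedWord

section Power

theorem isChain_flatten_replicate {α : Type*} {R : α → α → Prop} {l : List α}
    (h : (l ++ l).IsChain R) (n : ℕ) : (replicate n l).flatten.IsChain R := by
  obtain rfl | hne := eq_or_ne l []
  · simp
  rw [isChain_append] at h
  refine (isChain_flatten fun hmem => hne (eq_of_mem_replicate hmem).symm).2 ⟨?_, ?_⟩
  · exact fun _ hmem => (eq_of_mem_replicate hmem) ▸ h.1
  · exact isChain_replicate_of_rel n h.2.2

variable {V : Type*} {Γ : SimpleGraph V} {g : Grp Γ} {w : List (V × Bool)}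

/- If the top and bottom beads at some vertex were mutually inverse, `w` could be rewritten as
`x ⋯ x⁻¹`, and its conjugate `w.erase x ++ [x]` would be as long as `w` without being reduced. -/
theorem IsCancellationFree.append_self (hw : IsCancellationFree Γ w)
    (hcr : IsCyclicallyReduced (eval Γ w)) : IsCancellationFree Γ (w ++ w) := by
  classical
  intro v
  rw [pile_append, isChain_append]
  refine ⟨hw v, hw v, ?_⟩
  rintro _ hlast _ hhead ε rfl rfl
  have hx : IsStartingLetter Γ (v, !ε) w := hhead
  have hconj : IsConj (eval Γ w) (eval Γ (w.erase (v, !ε) ++ [(v, !ε)])) := by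
    rw [← hx.eval_cons_erase, eval_cons, eval_append]
    exact isConj_iff.2 ⟨(eval Γ [(v, !ε)])⁻¹, by group⟩
  have hlen : (w.erase (v, !ε) ++ [(v, !ε)]).length = w.length := by
    rw [length_append, length_singleton, length_erase_of_mem hx.mem,
      Nat.sub_add_cancel (length_pos_of_mem hx.mem)]
  have hfree : IsCancellationFree Γ (w.erase (v, !ε) ++ [(v, !ε)]) := by
    rw [isCancellationFree_iff_length_eval_eq] at hw ⊢
    exact le_antisymm (length_eval_le _) (hlen.le.trans (hw ▸ hcr _ hconj))
  have hpile : pile Γ w v = some (!ε) :: pile Γ (w.erase (v, !ε)) v := by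
    rw [← hx.pile_cons_erase, pile_cons_self (v, !ε)]
  have hlast' : some ε ∈ (pile Γ (w.erase (v, !ε)) v).getLast? := by
    rw [hpile, getLast?_cons, Option.mem_some_iff] at hlast
    cases hu : (pile Γ (w.erase (v, !ε)) v).getLast? <;> simp_all
  have hchain := hfree v
  rw [pile_append, isChain_append] at hchain
  refine hchain.2.2 _ hlast' (some !ε) ?_ ε rfl rfl
  exact isStartingLetter_cons_self (v, !ε) []

theorem IsCyclicallyReduced.length_pow (hg : IsCyclicallyReduced g) (n : ℕ) :
    length (g ^ n) = n * length g := by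
  obtain ⟨w, hw⟩ := exists_isReducedWordOf g
  obtain ⟨rfl, hfree⟩ := isReducedWordOf_iff.1 hw
  have hpow : IsCancellationFree Γ (replicate n w).flatten := by
    intro v
    rw [pile_flatten_replicate]
    exact isChain_flatten_replicate (pile_append w w v ▸ hfree.append_self hg v) n
  rw [isCancellationFree_iff_length_eval_eq] at hfree hpow
  rw [← eval_flatten_replicate, hpow, hfree]
  simp

end Power

section ConicalDecomposition

variable {V : Type*} {Γ : SimpleGraph V} {v₀ : V} {g a p a' p' : Grp Γ}

theorem exists_pile_append_eq (Γ : SimpleGraph V) (v₀ : V) (w : List (V × Bool)) :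
    ∃ A P, pile Γ (A ++ P) = pile Γ w ∧ (∀ x ∈ A, x.1 ≠ v₀) ∧
      ∀ x, IsStartingLetter Γ x P → x.1 = v₀ := by
  classical
  induction hn : w.length generalizing w with
  | zero =>
    obtain rfl := length_eq_zero_iff.1 hn
    exact ⟨[], [], rfl, by simp, fun x hx => absurd hx.mem not_mem_nil⟩
  | succ n ih =>
    by_cases hw : ∀ x, IsStartingLetter Γ x w → x.1 = v₀
    · exact ⟨[], w, rfl, by simp, hw⟩
    push Not at hw
    obtain ⟨x, hx, hne⟩ := hw
    obtain ⟨A, P, hpile, hA, hP⟩ := ih (w.erase x) (by rw [length_erase_of_mem hx.mem, hn]; rfl)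
    exact ⟨x :: A, P, (pile_cons_congr x hpile).trans hx.pile_cons_erase,
      forall_mem_cons.2 ⟨hne, hA⟩, hP⟩

theorem IsConical.mem_supp (hp : IsConical v₀ p) : v₀ ∈ supp p := by
  obtain ⟨ε, w, hw⟩ := hp.ge (Set.mem_singleton v₀)
  exact ⟨_, hw, ε, mem_cons_self⟩

theorem exists_conical_decomposition (hv₀ : v₀ ∈ supp g) :
    ∃ a p, IsGeodesicDecomposition g [a, p] ∧ v₀ ∉ supp a ∧ IsConical v₀ p := by
  obtain ⟨w, hw⟩ := exists_isReducedWordOf g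
  obtain ⟨A, P, hpile, hA, hP⟩ := exists_pile_append_eq Γ v₀ w
  have hAP : IsReducedWordOf (A ++ P) g := hw.of_pile_eq hpile.symm
  obtain ⟨hredA, hredP⟩ := hAP.of_append
  have hv₀A (ε : Bool) : (v₀, ε) ∉ A := fun hmem => hA _ hmem rfl
  refine ⟨_, _, hAP.isGeodesicDecomposition, ?_, Set.Subset.antisymm ?_ ?_⟩
  · rw [hredA.mem_supp_iff]
    exact fun ⟨ε, hε⟩ => hv₀A ε hε
  · intro v hv
    obtain ⟨ε, hε⟩ := hredP.mem_startingGenerators_iff.1 hv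
    exact hP _ hε
  · obtain ⟨ε, hε⟩ := hAP.mem_supp_iff.1 hv₀
    rw [Set.singleton_subset_iff, hredP.mem_startingGenerators_iff]
    obtain ⟨⟨v, δ⟩, P', rfl⟩ :=
      exists_cons_of_ne_nil (ne_nil_of_mem ((mem_append.1 hε).resolve_left (hv₀A ε)))
    have hstart := isStartingLetter_cons_self (Γ := Γ) (v, δ) P'
    obtain rfl : v = v₀ := hP _ hstart
    exact ⟨δ, hstart⟩

theorem pile_eq_nil_and_mem_of_pile_append_eq {A P A' P' : List (V × Bool)}
    (hP : ∀ x, IsStartingLetter Γ x P → x.1 = v₀) (hA' : ∀ x ∈ A', x.1 ≠ v₀)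
    (h : pile Γ (P ++ A) = pile Γ (A' ++ P')) : ∀ x ∈ A', pile Γ P x.1 = [] ∧ x ∈ A := by
  classical
  induction A' generalizing A with
  | nil => simp
  | cons y A' ih =>
    obtain ⟨hy, hA'⟩ := forall_mem_cons.1 hA'
    have hstart : IsStartingLetter Γ y (P ++ A) :=
      (isStartingLetter_cons_self y (A' ++ P')).congr h.symm
    obtain ⟨hPy, hAy⟩ := (isStartingLetter_append_iff.1 hstart).resolve_left (mt (hP y) hy)
    have hyP : y ∉ P := fun hmem => (pile_eq_nil_iff.1 hPy y hmem).1 rfl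
    have herase : pile Γ (P ++ A.erase y) = pile Γ (A' ++ P') := by
      refine pile_cons_cancel (x := y) ?_
      rw [← erase_append_right A hyP, hstart.pile_cons_erase, h, cons_append]
    refine forall_mem_cons.2 ⟨⟨hPy, hAy.mem⟩, fun x hx => ?_⟩
    exact (ih hA' herase x hx).imp_right mem_of_mem_erase

theorem IsConical.mem_supp_and_not_adj (hp : IsConical v₀ p) (ha' : v₀ ∉ supp a')
    (hg : IsGeodesicDecomposition g [p, a]) (hg' : IsGeodesicDecomposition g [a', p']) :
    ∀ c ∈ supp a', c ∈ supp a ∧ ∀ d ∈ supp p, ¬ Γ.Adj c d := by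
  obtain ⟨A, hA⟩ := exists_isReducedWordOf a
  obtain ⟨P, hP⟩ := exists_isReducedWordOf p
  obtain ⟨A', hA'⟩ := exists_isReducedWordOf a'
  obtain ⟨P', hP'⟩ := exists_isReducedWordOf p'
  have hstart (x : V × Bool) (hx : IsStartingLetter Γ x P) : x.1 = v₀ :=
    hp.le (hP.mem_startingGenerators_iff.2 ⟨x.2, hx⟩)
  have hne (x : V × Bool) (hx : x ∈ A') : x.1 ≠ v₀ :=
    fun h => ha' (h ▸ hA'.mem_supp_iff.2 ⟨x.2, hx⟩)
  intro c hc
  obtain ⟨ε, hε⟩ := hA'.mem_supp_iff.1 hc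
  obtain ⟨hnil, hmem⟩ := pile_eq_nil_and_mem_of_pile_append_eq hstart hne
    ((hP.append hg hA).pile_eq (hA'.append hg' hP')) _ hε
  refine ⟨hA.mem_supp_iff.2 ⟨ε, hmem⟩, fun d hd => ?_⟩
  obtain ⟨δ, hδ⟩ := hP.mem_supp_iff.1 hd
  exact (pile_eq_nil_iff.1 hnil _ hδ).2

theorem exists_adj_of_preconnected_induce {L X : Set V} (hL : (Γ.induce L).Preconnected)
    (hX : X.Nonempty) (hXL : X ⊂ L) : ∃ c ∈ X, ∃ d ∈ L \ X, Γ.Adj c d := by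
  obtain ⟨u, hu⟩ := hX
  obtain ⟨v, hvL, hvX⟩ := Set.exists_of_ssubset hXL
  obtain ⟨walk⟩ := hL ⟨u, hXL.subset hu⟩ ⟨v, hvL⟩
  obtain ⟨e, -, hfst, hsnd⟩ := walk.exists_boundary_dart {x | x.1 ∈ X} hu hvX
  exact ⟨_, hfst, _, ⟨e.snd.2, hsnd⟩, e.adj⟩

theorem IsConical.supp_ssubset (hp : IsConical v₀ p) (ha' : v₀ ∉ supp a')
    (hg : IsGeodesicDecomposition g [p, a]) (hg' : IsGeodesicDecomposition g [a', p'])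
    (hconn : (Γ.induce (supp g)).Preconnected) (ha : a ≠ 1) : supp a' ⊂ supp a := by
  have hsep := hp.mem_supp_and_not_adj ha' hg hg'
  have hsupp := supp_eq_union_of_isGeodesicDecomposition hg
  refine ssubset_of_subset_of_ne (fun c hc => (hsep c hc).1) fun heq => ?_
  have hproper : supp a ⊂ supp g := by
    refine Set.ssubset_iff_exists.2 ⟨hsupp ▸ Set.subset_union_right, v₀, ?_, heq ▸ ha'⟩
    exact hsupp ▸ Or.inl hp.mem_supp
  have hne : (supp a).Nonempty := Set.nonempty_iff_ne_empty.2 (mt eq_one_of_supp_eq_empty ha)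
  obtain ⟨c, hc, d, ⟨hdg, hda⟩, hadj⟩ := exists_adj_of_preconnected_induce hconn hne hproper
  exact (hsep c (heq ▸ hc)).2 d ((hsupp ▸ hdg : d ∈ supp p ∪ supp a).resolve_right hda) hadj

end ConicalDecomposition

section ConicalRotation

variable {V : Type*} {Γ : SimpleGraph V} {v₀ : V} {g a b p q c d : Grp Γ} {k : ℕ}

/-- `p` is a `v₀`-conical conjugate of `g` of the same length, of the kind that `k` rotations
`s * t ↦ t * s` starting at `g` produce: then `a` is the product of the prefixes `s` that were moved
to the back and `b` is the product, in reverse order, of the remainders `t`. -/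
structure IsConicalRotation (v₀ : V) (g p a b : Grp Γ) (k : ℕ) : Prop where
  isConical : IsConical v₀ p
  length_eq : length p = length g
  semiconjBy : SemiconjBy a p g
  pow_eq : g ^ k = a * b
  length_add_le : length a + length b ≤ k * length g

theorem IsConical.isConicalRotation (hg : IsConical v₀ g) : IsConicalRotation v₀ g g 1 1 0 where
  isConical := hg
  length_eq := rfl
  semiconjBy := SemiconjBy.one_left g
  pow_eq := by rw [pow_zero, mul_one]
  length_add_le := by rw [length_one, Nat.zero_mul]

namespace IsConicalRotation

theorem rotate (hlen : length (p * a) = length a + length p)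
    (hlen' : length (a * p) = length a + length p)
    (h : IsConicalRotation v₀ (p * a) q c d k) :
    IsConicalRotation v₀ (a * p) q (a * c) (d * p) (k + 1) where
  isConical := h.isConical
  length_eq := by rw [h.length_eq, hlen, hlen']
  semiconjBy := SemiconjBy.mul_left (mul_assoc a p a).symm h.semiconjBy
  pow_eq := by
    have hsemi : SemiconjBy a ((p * a) ^ k) ((a * p) ^ k) :=
      SemiconjBy.pow_right (mul_assoc a p a).symm k
    rw [pow_succ, ← mul_assoc, ← hsemi.eq, h.pow_eq]
    simp only [mul_assoc]
  length_add_le := by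
    have hac := length_mul_le a c
    have hdp := length_mul_le d p
    have hcd := h.length_add_le
    rw [hlen', Nat.succ_mul]
    rw [hlen] at hcd
    omega

variable (h : IsConicalRotation v₀ g p a b k)
include h

theorem eq_conj : g = a * p * a⁻¹ :=
  eq_mul_inv_of_mul_eq h.semiconjBy.eq.symm

theorem pow_add_eq (m : ℕ) : g ^ (k + m) = a * p ^ m * b := by
  rw [add_comm, pow_add, h.pow_eq, ← mul_assoc, ← (h.semiconjBy.pow_right m).eq]

theorem eq_inv_conj : g = b⁻¹ * p * b := by
  rw [mul_assoc, eq_inv_mul_iff_mul_eq]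
  refine mul_left_cancel (a := a) ?_
  rw [← mul_assoc, ← h.pow_eq, ← pow_succ, h.pow_add_eq 1, pow_one, mul_assoc]

theorem sum_length_le (hg : IsCyclicallyReduced g) (m : ℕ) :
    length a + m * length p + length b ≤ length (g ^ (k + m)) := by
  have hab := h.length_add_le
  rw [hg.length_pow, h.length_eq, Nat.add_mul]
  omega

theorem isGeodesicDecomposition_pow (hg : IsCyclicallyReduced g) :
    IsGeodesicDecomposition (g ^ k) [a, b] := by
  refine isGeodesicDecomposition_of_sum_le (by simpa using h.pow_eq) ?_
  simpa using h.sum_length_le hg 0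

theorem isGeodesicDecomposition_pow_add (hg : IsCyclicallyReduced g) (m : ℕ) :
    IsGeodesicDecomposition (g ^ (k + m)) [a, p ^ m, b] := by
  refine isGeodesicDecomposition_of_sum_le (by simp [h.pow_add_eq, mul_assoc]) ?_
  have hp := length_pow_le p m
  have hsum := h.sum_length_le hg m
  simp only [map_cons, map_nil, sum_cons, sum_nil]
  omega

theorem isGeodesicDecomposition_pow_add_replicate (hg : IsCyclicallyReduced g) (m : ℕ) :
    IsGeodesicDecomposition (g ^ (k + m)) ([a] ++ replicate m p ++ [b]) := by
  refine isGeodesicDecomposition_of_sum_le (by simp [h.pow_add_eq, mul_assoc]) ?_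
  simpa [add_assoc] using h.sum_length_le hg m

end IsConicalRotation

theorem exists_isConicalRotation (hcr : IsCyclicallyReduced g)
    (hconn : (Γ.induce (supp g)).Preconnected) (hg : IsGeodesicDecomposition g [a, p])
    (ha : v₀ ∉ supp a) (hp : IsConical v₀ p) :
    ∃ q c d k, k ≤ (supp a).ncard ∧ IsConicalRotation v₀ g q c d k := by
  induction hn : (supp a).ncard using Nat.strong_induction_on generalizing g a p with
  | _ n ih =>
    obtain ⟨rfl, hlen⟩ := isGeodesicDecomposition_pair_iff.1 hg
    obtain rfl | hne := eq_or_ne a 1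
    · rw [one_mul] at hcr ⊢
      exact ⟨_, _, _, 0, Nat.zero_le _, hp.isConicalRotation⟩
    have hconj : IsConj (a * p) (p * a) := isConj_iff.2 ⟨a⁻¹, by group⟩
    have hle : length (p * a) ≤ length (a * p) := by
      rw [hlen, add_comm]
      exact length_mul_le p a
    have hlen' : length (p * a) = length a + length p := by
      rw [← hlen]
      exact le_antisymm hle (hcr _ hconj)
    have hpa : IsGeodesicDecomposition (p * a) [p, a] :=
      isGeodesicDecomposition_pair_iff.2 ⟨rfl, hlen'.trans (add_comm _ _)⟩
    have hsupp := supp_eq_union_of_isGeodesicDecomposition hpa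
    rw [supp_eq_union_of_isGeodesicDecomposition hg, Set.union_comm, ← hsupp] at hconn
    obtain ⟨a', p', hpa', ha', hp'⟩ :=
      exists_conical_decomposition (hsupp ▸ Or.inl hp.mem_supp : v₀ ∈ supp (p * a))
    have hlt : (supp a').ncard < n :=
      hn ▸ Set.ncard_lt_ncard (hp.supp_ssubset ha' hpa hpa' hconn hne) (finite_supp a)
    obtain ⟨q, c, d, k, hk, hrot⟩ :=
      ih _ hlt (hcr.of_isConj hconj hle) hconn hpa' ha' hp' rfl
    exact ⟨q, a * c, d * p, k + 1, hk.trans_lt hlt, hrot.rotate hlen' hlen⟩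

end ConicalRotation

end RAAG

theorem mainTheorem5_general {V : Type*} {Γ : SimpleGraph V} {g : RAAG.Grp Γ}
    (hns : RAAG.IsNonSplit g) (hcr : RAAG.IsCyclicallyReduced g)
    {v₀ : V} (hv₀ : v₀ ∈ RAAG.supp g) :
    ∃ (p a b : RAAG.Grp Γ) (k : ℕ),
      RAAG.IsConical v₀ p ∧
      g = a * p * a⁻¹ ∧
      g = b⁻¹ * p * b ∧
      k < (RAAG.supp g).ncard ∧
      RAAG.IsGeodesicDecomposition (g ^ k) [a, b] ∧
      ∀ n : ℕ, k ≤ n →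
        RAAG.IsGeodesicDecomposition (g ^ n) [a, p ^ (n - k), b] ∧
        RAAG.IsGeodesicDecomposition (g ^ n) ([a] ++ List.replicate (n - k) p ++ [b]) := by
  obtain ⟨s, t, hst, hs, ht⟩ := RAAG.exists_conical_decomposition hv₀
  obtain ⟨p, a, b, k, hk, hrot⟩ :=
    RAAG.exists_isConicalRotation hcr hns.preconnected hst hs ht
  have hss : RAAG.supp s ⊂ RAAG.supp g := by
    rw [Set.ssubset_iff_exists, RAAG.supp_eq_union_of_isGeodesicDecomposition hst]
    exact ⟨Set.subset_union_left, v₀, Or.inr ht.mem_supp, hs⟩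
  refine ⟨p, a, b, k, hrot.isConical, hrot.eq_conj, hrot.eq_inv_conj,
    hk.trans_lt (Set.ncard_lt_ncard hss (RAAG.finite_supp g)),
    hrot.isGeodesicDecomposition_pow hcr, fun n hn => ?_⟩
  obtain ⟨m, rfl⟩ := Nat.exists_eq_add_of_le hn
  rw [Nat.add_sub_cancel_left]
  exact ⟨hrot.isGeodesicDecomposition_pow_add hcr m,
    hrot.isGeodesicDecomposition_pow_add_replicate hcr m⟩

theorem mainTheorem5 {V : Type*} [Fintype V] (Γ : SimpleGraph V) (g : RAAG.Grp Γ)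
    (hns : RAAG.IsNonSplit g) (hcr : RAAG.IsCyclicallyReduced g)
    (v₀ : V) (hv₀ : v₀ ∈ RAAG.supp g) :
    ∃ (p a b : RAAG.Grp Γ) (k : ℕ),
      RAAG.IsConical v₀ p ∧
      g = a * p * a⁻¹ ∧
      g = b⁻¹ * p * b ∧
      k ≤ Fintype.card V - 1 ∧
      RAAG.IsGeodesicDecomposition (g ^ k) [a, b] ∧
      ∀ n : ℕ, Fintype.card V ≤ n →
        RAAG.IsGeodesicDecomposition (g ^ n) [a, p ^ (n - k), b] ∧
        RAAG.IsGeodesicDecomposition (g ^ n) ([a] ++ List.replicate (n - k) p ++ [b]) := by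
  obtain ⟨p, a, b, k, hp, ha, hb, hk, hab, hpow⟩ := mainTheorem5_general hns hcr hv₀
  have hkV := hk.trans_le (Nat.card_eq_fintype_card (α := V) ▸ Set.ncard_le_card (RAAG.supp g))
  exact ⟨p, a, b, k, hp, ha, hb, Nat.le_sub_one_of_lt hkV, hab,
    fun n hn => hpow n (hkV.le.trans hn)⟩
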